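/- Graphs are undirected and simple; $|X|$ denotes the number of vertices of $X$, and $x\mathrel{\mathcal E}y$ means that $x,y$ are adjacent. A subgraph of $X$ is given by a subset of the vertices and a subset of the edges of $X$ between them (not necessarily induced). * The coloring number $\mathrm{Col}(X)$ is the least (finite or infinite) cardinal $\kappa$ such that the vertex set of $X$ has a well-ordering $\triangleleft$ with $|\{y : y\mathrel{\mathcal E}x,\ y\triangleleft x\}|<\kappa$ for every vertex $x$. * The list-chromatic number $\mathrm{List}(X)$ is the least (finite or infinite) cardinal $\kappa$ such that for every function $F$ assigning to each vertex $x$ a set $F(x)$ of ordinals with $|F(x)|=\kappa$ there is a function $f$ on the vertices with $f(x)\in F(x)$ for all $x$ and $f(x)\neq f(y)$ whenever $x\mathrel{\mathcal E}y$. * For a cardinal $\lambda$, $\mathrm{AP}_\lambda$ is the statement that there are a sequence $\langle c_\xi\mid \xi<\lambda^+\rangle$ with $c_\xi\subseteq\xi$ for all $\xi<\lambda^+$, and a club $C\subseteq\lambda^+$, such that for every $\alpha\in C$: $c_\alpha$ is unbounded in $\alpha$ and has order type $\mathrm{cf}(\alpha)$, and $\{c_\alpha\cap\xi\mid\xi<\alpha\}\subseteq\{c_\xi\mid\xi<\alpha\}$.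 **Proposition 1.8.** Let $X$ be a graph with $\mathrm{Col}(X)>\omega_1$. Suppose that $\lambda^\omega=\lambda$ for every regular uncountable cardinal $\lambda<|X|$, and that $\mathrm{AP}_\lambda$ holds for every singular cardinal $\lambda<|X|$ of countable cofinality. Then $X$ contains a subgraph which is isomorphic to the complete bipartite graph $K_{\omega,\omega_1}$. Moreover, $X$ contains a subgraph $Y$ with $|Y|=\omega_1$ and $\mathrm{List}(Y)>\omega$. -/

import Mathlib

open Cardinal Order

universe u

namespace SimpleGraph

variable {V : Type u}

/-- `G.HasColoringOrder κ`: the vertex set has a well-ordering such that every vertex has fewer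
than `κ` neighbours below it. -/
def HasColoringOrder (G : SimpleGraph V) (κ : Cardinal.{u}) : Prop :=
  ∃ r : V → V → Prop, IsWellOrder V r ∧ ∀ x : V, #{y : V | G.Adj x y ∧ r y x} < κ

/-- The coloring number `Col(G)`: the least (finite or infinite) cardinal `κ` such that the vertex
set has a well-ordering in which every vertex has fewer than `κ` smaller neighbours. -/
noncomputable def coloringNumber (G : SimpleGraph V) : Cardinal.{u} :=
  sInf {κ | G.HasColoringOrder κ}

/-- `G.IsListColorable κ`: for every assignment `F` of sets of ordinals of size exactly `κ` to the
vertices there is a good coloring `f` (adjacent vertices get different ordinals) with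
`f x ∈ F x` for all `x`. -/
def IsListColorable (G : SimpleGraph V) (κ : Cardinal.{u}) : Prop :=
  ∀ F : V → Set Ordinal.{u}, (∀ x, #(F x) = Cardinal.lift.{u + 1} κ) →
    ∃ f : V → Ordinal.{u}, (∀ x y, G.Adj x y → f x ≠ f y) ∧ ∀ x, f x ∈ F x

/-- The list-chromatic number `List(G)`: the least (finite or infinite) cardinal `κ` such that
every `κ`-assignment admits a good coloring. -/
noncomputable def listChromaticNumber (G : SimpleGraph V) : Cardinal.{u} :=
  sInf {κ | G.IsListColorable κ}

/-- The infimum defining the coloring number is over a nonempty set. -/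
theorem hasColoringOrder_succ_mk (G : SimpleGraph V) : G.HasColoringOrder (succ #V) :=
  ⟨WellOrderingRel, inferInstance, fun _ => lt_succ_of_le (mk_set_le _)⟩

/-- The infimum defining the list-chromatic number is over a nonempty set. -/
theorem isListColorable_succ_mk (G : SimpleGraph V) : G.IsListColorable (succ #V) := by
  intro F hF
  have key : ∀ (x : V) (g : ∀ y : V, WellOrderingRel y x → Ordinal.{u}),
      ∃ a ∈ F x, ∀ (y : V) (h : WellOrderingRel y x), g y h ≠ a := by
    intro x g
    by_contra! hcon
    have hsub : F x ⊆ Set.range (fun p : {y : V // WellOrderingRel y x} => g p.1 p.2) := by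
      intro a ha
      obtain ⟨y, h, rfl⟩ := hcon a ha
      exact ⟨⟨y, h⟩, rfl⟩
    have h1 := mk_le_mk_of_subset hsub
    have h2 := mk_range_le_lift (f := fun p : {y : V // WellOrderingRel y x} => g p.1 p.2)
    rw [hF x] at h1
    have h3 : Cardinal.lift.{u + 1} #{y : V // WellOrderingRel y x} ≤ Cardinal.lift.{u + 1} #V :=
      Cardinal.lift_le.2 (mk_subtype_le _)
    have h4 : Cardinal.lift.{u + 1} (succ #V) ≤ Cardinal.lift.{u + 1} #V := by
      refine h1.trans (le_trans ?_ h3)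
      rwa [Cardinal.lift_id'.{u, u + 1}] at h2
    exact absurd (Cardinal.lift_le.1 h4) (not_le.2 (lt_succ _))
  choose pick hpick hne using key
  have wf : WellFounded (WellOrderingRel : V → V → Prop) := IsWellFounded.wf
  let f : V → Ordinal.{u} := wf.fix pick
  have hf : ∀ x, f x = pick x (fun y _ => f y) := fun x => wf.fix_eq pick x
  refine ⟨f, ?_, fun x => ?_⟩
  · intro x y hxy
    rcases trichotomous_of WellOrderingRel x y with h | h | h
    · rw [hf y]
      exact hne y (fun z _ => f z) x h
    · exact absurd h hxy.ne
    · rw [hf x]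
      exact (hne x (fun z _ => f z) y h).symm
  · rw [hf x]
    exact hpick x _

end SimpleGraph

/-- The approachability principle `AP_μ`: there is a sequence `⟨c_ξ | ξ < μ⁺⟩` with `c_ξ ⊆ ξ` and a
club `C` in `μ⁺` such that for all `α ∈ C`: `c_α` is unbounded in `α`, its order type is `cf(α)`,
and every `c_α ∩ ξ` with `ξ < α` is one of the `c_η` with `η < α`. Ordinals are identified with
their sets of predecessors, and the values of `c` outside `μ⁺` are irrelevant. -/
def ApproachabilityPrinciple (μ : Cardinal.{u}) : Prop :=
  ∃ c : Ordinal.{u} → Set Ordinal.{u},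
    (∀ ξ < (succ μ).ord, c ξ ⊆ Set.Iio ξ) ∧
    ∃ C : Set (Set.Iio (succ μ).ord), IsClub C ∧
      ∀ α : Set.Iio (succ μ).ord, α ∈ C →
        (∀ β < α.1, ∃ γ ∈ c α.1, β ≤ γ) ∧
        Ordinal.type (fun a b : c α.1 => a < b) = Ordinal.lift.{u + 1} α.1.cof.ord ∧
        ∀ ξ < α.1, ∃ η < α.1, c α.1 ∩ Set.Iio ξ = c η

universe v

/-! Contrapositive: if some infinite set of vertices has uncountably many common neighbours, it
spans a `K_{ω,ω₁}`. Otherwise `CountableCommonNeighbors` holds, and induction on the number of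
vertices yields a coloring order for `ℵ₁`, against the hypothesis on the coloring number.

The induction step needs a rank function with fibers smaller than `#V` such that each vertex has
countably many neighbours of lower rank; orders on the fibers are then concatenated
(`hasColoringOrder_aleph_one_of_rank`). If cardinals `μ = μ ^ ℵ₀` are cofinal below `#V`, the rank
comes from closing initial segments under `infiniteNeighbors` (`exists_rank_of_power`). The
remaining case is `#V = μ⁺` with `μ` singular of countable cofinality, where the approachability
sequence guesses the small sets under which to close (`exists_bounding_sets`,
`exists_rank_of_approachability`).

For the list-chromatic number, `ℵ₁ < #V` makes the power hypothesis give CH, so the `ω₁` side of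
`K_{ω,ω₁}` can enumerate all functions `ℕ → ℕ` and diagonalize against every coloring of the
countable side. -/

/-- A chain of finite sets has a countable union. -/
theorem Set.countable_iUnion_of_monotone_finite {ι V : Type*} [LinearOrder ι] {S : ι → Set V}
    (hS : Monotone S) (hfin : ∀ i, (S i).Finite) : (⋃ i, S i).Countable := by
  rw [← Set.sUnion_range]
  refine Set.Countable.sUnion ?_ (by rintro _ ⟨i, rfl⟩; exact (hfin i).countable)
  -- A chain has at most one member of each finite size.
  refine Set.MapsTo.countable_of_injOn (f := Set.ncard) (t := Set.univ)
    (fun _ _ => Set.mem_univ _) ?_ Set.countable_univ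
  rintro _ ⟨i, rfl⟩ _ ⟨j, rfl⟩ h
  rcases le_total i j with hij | hij
  · exact Set.eq_of_subset_of_ncard_le (hS hij) h.ge (hfin j)
  · exact (Set.eq_of_subset_of_ncard_le (hS hij) h.le (hfin i)).symm

/-! ### Cardinality bounds -/

namespace Cardinal

theorem countable_iff_mk_lt_aleph_one {α : Type u} {s : Set α} : s.Countable ↔ #s < ℵ₁ := by
  rw [← succ_aleph0, lt_succ_iff, le_aleph0_iff_set_countable]

theorem mk_iUnion_le_of_forall_le {α : Type u} {ι : Type v} {f : ι → Set α} {μ : Cardinal.{u}}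
    (hμ : ℵ₀ ≤ μ) (hι : lift.{u} #ι ≤ lift.{v} μ) (hf : ∀ i, #(f i) ≤ μ) : #(⋃ i, f i) ≤ μ := by
  rw [← lift_le.{v}]
  refine (mk_iUnion_le_sum_mk_lift).trans ((sum_le_sum _ (fun _ => μ) hf).trans ?_)
  rw [sum_const]
  refine (mul_le_mul' hι le_rfl).trans (mul_eq_self ?_).le
  simpa using hμ

theorem mk_lt_preimage_le {V : Type u} {o : V → Ordinal.{u}} (ho : Function.Injective o)
    (α : Ordinal.{u}) : #{x | o x < α} ≤ α.card := by
  have h := lift_mk_le_lift_mk_of_injective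
    (f := fun x : {x | o x < α} => (⟨o x, x.2⟩ : Set.Iio α))
    (fun x y hxy => Subtype.ext (ho (congrArg Subtype.val hxy)))
  rw [mk_Iio_ordinal, lift_lift, lift_le] at h
  exact h

theorem exists_injective_lt_ord (V : Type u) : ∃ o : V → Ordinal.{u},
    Function.Injective o ∧ ∀ x, o x < (#V).ord := by
  obtain ⟨r, hr, hord⟩ := exists_ord_eq V
  exact ⟨fun x => Ordinal.typein r x, Ordinal.typein_injective r,
    fun x => hord ▸ Ordinal.typein_lt_type r x⟩

end Cardinal

/-! ### Concatenating orders, and ranks from closures -/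

namespace SimpleGraph

variable {V : Type u}

/-- Every infinite set of vertices has only countably many common neighbours. -/
def CountableCommonNeighbors (G : SimpleGraph V) : Prop :=
  ∀ A : Set V, A.Infinite → {y | ∀ x ∈ A, G.Adj y x}.Countable

/-- The vertices with infinitely many neighbours in `S`. -/
def infiniteNeighbors (G : SimpleGraph V) (S : Set V) : Set V :=
  {y | (G.neighborSet y ∩ S).Infinite}

theorem infiniteNeighbors_mono (G : SimpleGraph V) {S T : Set V} (h : S ⊆ T) :
    G.infiniteNeighbors S ⊆ G.infiniteNeighbors T :=
  fun _ hy => Set.Infinite.mono (Set.inter_subset_inter_right _ h) hy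

theorem CountableCommonNeighbors.induce {G : SimpleGraph V} (h : G.CountableCommonNeighbors)
    (S : Set V) : (G.induce S).CountableCommonNeighbors := by
  intro A hA
  have hA' : (Subtype.val '' A).Infinite := hA.image Subtype.val_injective.injOn
  refine ((h _ hA').preimage Subtype.val_injective).mono ?_
  rintro y hy _ ⟨x, hx, rfl⟩
  exact hy x hx

/-- Each such vertex is a common neighbour of some injective `ω`-sequence in `S`; there are at most
`μ ^ ℵ₀ = μ` sequences, each with countably many common neighbours. -/
theorem CountableCommonNeighbors.mk_infiniteNeighbors_le {G : SimpleGraph V}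
    (h : G.CountableCommonNeighbors) {μ : Cardinal.{u}} (hμ : ℵ₀ ≤ μ) (hpow : μ ^ ℵ₀ = μ)
    {S : Set V} (hS : #S ≤ μ) : #(G.infiniteNeighbors S) ≤ μ := by
  have hsub : G.infiniteNeighbors S ⊆
      ⋃ f : ℕ ↪ S, {y | ∀ x ∈ Set.range (fun n => (f n : V)), G.Adj y x} := by
    intro y hy
    let g := Set.Infinite.natEmbedding _ hy
    refine Set.mem_iUnion.2 ⟨⟨fun n => ⟨g n, (g n).2.2⟩, ?_⟩, ?_⟩
    · intro a b hab
      simp only [Subtype.mk.injEq] at hab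
      exact g.injective (Subtype.ext hab)
    · rintro _ ⟨n, rfl⟩
      exact (g n).2.1
  refine (mk_le_mk_of_subset hsub).trans ?_
  have hfib : ∀ f : ℕ ↪ S,
      #{y | ∀ x ∈ Set.range (fun n => (f n : V)), G.Adj y x} ≤ μ := fun f =>
    (le_aleph0_iff_set_countable.2 (h _ (Set.infinite_range_of_injective
      (Subtype.val_injective.comp f.injective)))).trans hμ
  have : #(ℕ ↪ S) ≤ μ := by
    refine (mk_le_of_injective (f := fun f : ℕ ↪ S => (f : ℕ → S)) DFunLike.coe_injective).trans ?_
    have h1 : #(ℕ → S) = #S ^ ℵ₀ := by simp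
    rw [h1, ← hpow]
    exact power_le_power_right hS
  exact mk_iUnion_le_of_forall_le hμ (by simpa using this) hfib

theorem hasColoringOrder_of_injective {L : Type*} [LinearOrder L] [WellFoundedLT L]
    {G : SimpleGraph V} {κ : Cardinal.{u}} (f : V → L) (hf : Function.Injective f)
    (h : ∀ x, #{y | G.Adj x y ∧ f y < f x} < κ) : G.HasColoringOrder κ :=
  ⟨fun x y => f x < f y,
    (RelEmbedding.mk (s := ((· < ·) : L → L → Prop)) ⟨f, hf⟩ Iff.rfl).isWellOrder, h⟩

theorem HasColoringOrder.exists_injective {G : SimpleGraph V} {κ : Cardinal.{u}}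
    (h : G.HasColoringOrder κ) : ∃ f : V → Ordinal.{u}, Function.Injective f ∧
      ∀ x, #{y | G.Adj x y ∧ f y < f x} < κ := by
  obtain ⟨r, hr, h⟩ := h
  refine ⟨fun x => Ordinal.typein r x, Ordinal.typein_injective r, fun x => ?_⟩
  simpa [Ordinal.typein_lt_typein] using h x

/-- Coloring orders on the fibers of a rank function can be concatenated. -/
theorem hasColoringOrder_aleph_one_of_rank {G : SimpleGraph V} (ρ : V → Ordinal.{u})
    (hρ : ∀ x, (G.neighborSet x ∩ {y | ρ y < ρ x}).Countable)
    (hfib : ∀ x, (G.induce {y | ρ y = ρ x}).HasColoringOrder ℵ₁) : G.HasColoringOrder ℵ₁ := by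
  have key : ∀ i : Ordinal.{u}, ∃ f : {y | ρ y = i} → Ordinal.{u}, Function.Injective f ∧
      ∀ x, #{y | (G.induce {y | ρ y = i}).Adj x y ∧ f y < f x} < ℵ₁ := by
    intro i
    by_cases hi : ∃ x, ρ x = i
    · obtain ⟨x, rfl⟩ := hi
      exact (hfib x).exists_injective
    · have : IsEmpty {y | ρ y = i} := ⟨fun y => hi ⟨y.1, y.2⟩⟩
      exact ⟨isEmptyElim, fun x => isEmptyElim x, fun x => isEmptyElim x⟩
  choose f hf hcount using key
  let F : V → Ordinal.{u} ×ₗ Ordinal.{u} := fun x => toLex (ρ x, f (ρ x) ⟨x, rfl⟩)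
  have hF : ∀ x y (h : ρ y = ρ x), f (ρ y) ⟨y, rfl⟩ = f (ρ x) ⟨y, h⟩ := by
    intro x y h
    have : ∀ i (h : ρ y = i), f (ρ y) ⟨y, rfl⟩ = f i ⟨y, h⟩ := by
      rintro i rfl; rfl
    exact this _ h
  refine hasColoringOrder_of_injective F ?_ fun x => ?_
  · intro x y hxy
    have h := Prod.ext_iff.1 (toLex.injective hxy)
    have h1 : ρ y = ρ x := h.1.symm
    have h2 := h.2
    simp only [] at h2
    rw [hF x y h1] at h2
    exact congrArg Subtype.val (hf _ h2)
  · rw [← countable_iff_mk_lt_aleph_one]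
    have h1 : {y | (G.induce {y | ρ y = ρ x}).Adj ⟨x, rfl⟩ y ∧
        f (ρ x) y < f (ρ x) ⟨x, rfl⟩}.Countable :=
      countable_iff_mk_lt_aleph_one.2 (hcount (ρ x) ⟨x, rfl⟩)
    refine ((hρ x).union (h1.image Subtype.val)).mono ?_
    rintro y ⟨hadj, hlt⟩
    rcases Prod.Lex.toLex_lt_toLex.1 hlt with h | ⟨h, h'⟩
    · exact Or.inl ⟨hadj, h⟩
    · simp only [] at h h'
      rw [hF x y h] at h'
      exact Or.inr ⟨⟨y, h⟩, ⟨hadj, h'⟩, rfl⟩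

/-- The closure of `A` after `n` steps of adding the vertices with infinitely many neighbours. -/
def closureStep (G : SimpleGraph V) (A : Set V) : ℕ → Set V
  | 0 => A
  | n + 1 => G.infiniteNeighbors (closureStep G A n)

theorem closureStep_mono (G : SimpleGraph V) {A B : Set V} (h : A ⊆ B) (n : ℕ) :
    G.closureStep A n ⊆ G.closureStep B n := by
  induction n with
  | zero => exact h
  | succ n ih => exact G.infiniteNeighbors_mono ih

theorem CountableCommonNeighbors.mk_closureStep_le {G : SimpleGraph V}
    (h : G.CountableCommonNeighbors) {μ : Cardinal.{u}} (hμ : ℵ₀ ≤ μ) (hpow : μ ^ ℵ₀ = μ)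
    {A : Set V} (hA : #A ≤ μ) (n : ℕ) : #(G.closureStep A n) ≤ μ := by
  induction n with
  | zero => exact hA
  | succ n ih => exact h.mk_infiniteNeighbors_le hμ hpow ih

/-- The rank of `x` is the first `α` whose `ω`-step closure `cl α` contains `x`. Below that rank `x`
has only finitely many neighbours in each `closureStep (A α) n`, since otherwise `x` would enter at
step `n + 1`. For fixed `n` these finite sets increase with `α`, so their union is countable however
long the chain. -/
theorem CountableCommonNeighbors.exists_rank_of_power {G : SimpleGraph V}
    (h : G.CountableCommonNeighbors)
    (hpow : ∀ ν < #V, ∃ μ < #V, ν ≤ μ ∧ ℵ₀ ≤ μ ∧ μ ^ ℵ₀ = μ) :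
    ∃ ρ : V → Ordinal.{u}, (∀ x, (G.neighborSet x ∩ {y | ρ y < ρ x}).Countable) ∧
      ∀ x, #{y | ρ y = ρ x} < #V := by
  obtain ⟨o, hinj, ho⟩ := Cardinal.exists_injective_lt_ord V
  let A : Ordinal.{u} → Set V := fun α => {z | o z < α}
  have hA : Monotone A := fun α β hαβ z hz => lt_of_lt_of_le hz hαβ
  let cl : Ordinal.{u} → Set V := fun α => ⋃ n, G.closureStep (A α) n
  have hne : ∀ x, {α | x ∈ cl α}.Nonempty := fun x =>
    ⟨succ (o x), Set.mem_iUnion.2 ⟨0, lt_succ (o x)⟩⟩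
  let ρ : V → Ordinal.{u} := fun x => sInf {α | x ∈ cl α}
  have hmem : ∀ x, x ∈ cl (ρ x) := fun x => csInf_mem (hne x)
  have hnot : ∀ x, ∀ α < ρ x, x ∉ cl α := fun x α hα => fun hx =>
    notMem_of_lt_csInf' (s := {α | x ∈ cl α}) hα hx
  refine ⟨ρ, fun x => ?_, fun x => ?_⟩
  · have hsub : G.neighborSet x ∩ {y | ρ y < ρ x} ⊆
        ⋃ n, ⋃ α : Set.Iio (ρ x), G.neighborSet x ∩ G.closureStep (A α) n := by
      rintro y ⟨hadj, hy⟩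
      obtain ⟨n, hn⟩ := Set.mem_iUnion.1 (hmem y)
      exact Set.mem_iUnion.2 ⟨n, Set.mem_iUnion.2 ⟨⟨ρ y, hy⟩, hadj, hn⟩⟩
    refine (Set.countable_iUnion fun n => ?_).mono hsub
    refine Set.countable_iUnion_of_monotone_finite ?_ ?_
    · intro α β hαβ
      exact Set.inter_subset_inter_right _ (G.closureStep_mono (hA hαβ) n)
    · intro α
      by_contra hinf
      exact hnot x α α.2 (Set.mem_iUnion.2 ⟨n + 1, hinf⟩)
  · have hle : succ (o x) < (#V).ord ∨ #V < ℵ₀ := by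
      by_cases hV : ℵ₀ ≤ #V
      · exact Or.inl ((isSuccLimit_ord hV).succ_lt (ho x))
      · exact Or.inr (not_le.1 hV)
    have hρ : ρ x ≤ succ (o x) := csInf_le' (Set.mem_iUnion.2 ⟨0, lt_succ (o x)⟩)
    have hpos : #V ≠ 0 := mk_ne_zero_iff.2 ⟨x⟩
    -- The case `ν = 0` already forces `V` to be infinite.
    obtain ⟨μ₀, hμ₀, -, hinf, -⟩ := hpow 0 (pos_iff_ne_zero.2 hpos)
    have hlt : ρ x < (#V).ord := by
      rcases hle with hle | hle
      · exact hρ.trans_lt hle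
      · exact absurd (hinf.trans hμ₀.le) (not_le.2 hle)
    obtain ⟨μ, hμ, hν, hμ₁, hμ₂⟩ := hpow _ (lt_ord.1 hlt)
    refine lt_of_le_of_lt ?_ hμ
    have hsub : {y | ρ y = ρ x} ⊆ cl (ρ x) := fun y hy => (show ρ y = ρ x from hy) ▸ hmem y
    refine (mk_le_mk_of_subset hsub).trans ?_
    exact mk_iUnion_le_of_forall_le hμ₁ (by simpa using hμ₁) fun n =>
      h.mk_closureStep_le hμ₁ hμ₂ ((mk_lt_preimage_le hinj _).trans hν) n

end SimpleGraph

/-! ### Cofinalities and clubs in a successor cardinal -/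

namespace Ordinal

theorem exists_nat_cofinal_of_cof_le {δ : Ordinal.{u}} (hδ : δ ≠ 0) (hcof : δ.cof ≤ ℵ₀) :
    ∃ s : ℕ → Ordinal.{u}, (∀ n, s n < δ) ∧ ∀ β < δ, ∃ n, β ≤ s n := by
  obtain ⟨t, ht, hcard⟩ := Order.exists_cof_eq (Set.Iio δ)
  have hne : Nonempty (Set.Iio δ) := ⟨⟨0, pos_iff_ne_zero.2 hδ⟩⟩
  have hc : t.Countable := by
    rw [← le_aleph0_iff_set_countable, hcard, cof_Iio, ← lift_cof,
      ← Cardinal.lift_aleph0.{u + 1, u}, Cardinal.lift_le]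
    exact hcof
  obtain ⟨f, hf⟩ := hc.exists_eq_range ht.nonempty
  refine ⟨fun n => f n, fun n => (f n).2, fun β hβ => ?_⟩
  obtain ⟨γ, hγ, hle⟩ := ht ⟨β, hβ⟩
  rw [hf] at hγ
  obtain ⟨n, rfl⟩ := hγ
  exact ⟨n, hle⟩

end Ordinal

theorem IsClub.mem_of_forall_lt_exists {κ : Ordinal.{u}} {C : Set (Set.Iio κ)} (hC : IsClub C)
    {δ : Set.Iio κ} (hδ : δ.1 ≠ 0) (h : ∀ η < δ.1, ∃ γ ∈ C, η < γ.1 ∧ γ.1 ≤ δ.1) : δ ∈ C := by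
  refine hC.isLUB_mem (t := {γ | γ ∈ C ∧ γ ≤ δ}) (fun γ hγ => hγ.1) ?_ ⟨fun γ hγ => hγ.2, ?_⟩
  · obtain ⟨γ, hγ, -, hle⟩ := h 0 (pos_iff_ne_zero.2 hδ)
    exact ⟨γ, hγ, hle⟩
  · intro b hb
    by_contra hlt
    obtain ⟨γ, hγ, hbγ, hle⟩ := h b.1 (not_le.1 hlt)
    exact absurd (hb ⟨hγ, hle⟩) (not_le.2 hbγ)

namespace Cardinal

/-- A set of size at most `μ`, where `μ` has countable cofinality, is a countable union of sets
whose sizes are bounded by a fixed sequence below `μ`. -/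
theorem exists_nat_decomposition {μ : Cardinal.{u}} (hμ : ℵ₀ ≤ μ) (hcof : μ.ord.cof = ℵ₀)
    (V : Type u) : ∃ ν : ℕ → Cardinal.{u}, (∀ n, ν n < μ) ∧ ∀ S : Set V, #S ≤ μ →
      ∃ e : ℕ → Set V, S ⊆ ⋃ n, e n ∧ ∀ n, #(e n) ≤ ν n := by
  have hlim := isSuccLimit_ord hμ
  obtain ⟨s, hs, hcofinal⟩ := Ordinal.exists_nat_cofinal_of_cof_le hlim.ne_bot hcof.le
  refine ⟨fun n => (s n).card, fun n => lt_ord.1 (hs n), fun S hS => ?_⟩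
  obtain ⟨o, hinj, ho⟩ := exists_injective_lt_ord S
  refine ⟨fun n => Subtype.val '' {x | o x < s n}, fun x hx => ?_, fun n => ?_⟩
  · obtain ⟨n, hn⟩ := hcofinal (succ (o ⟨x, hx⟩))
      (hlim.succ_lt ((ho _).trans_le (ord_le_ord.2 hS)))
    exact Set.mem_iUnion.2 ⟨n, ⟨x, hx⟩, (lt_succ _).trans_le hn, rfl⟩
  · exact mk_image_le.trans (mk_lt_preimage_le hinj _)

/-- An infinite cofinality is a regular cardinal, so it cannot equal the singular `μ`. -/
theorem IsSingular.cof_lt_of_lt_ord_succ {μ : Cardinal.{u}} (hμ : μ.IsSingular)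
    {α : Ordinal.{u}} (hα : α < (succ μ).ord) : α.cof < μ := by
  have hle : α.cof ≤ μ := (Ordinal.cof_le_card α).trans (lt_succ_iff.1 (lt_ord.1 hα))
  by_cases hinf : ℵ₀ ≤ α.cof
  · refine hle.lt_of_ne fun h => hμ.not_isRegular ?_
    exact h ▸ isRegular_cof (Ordinal.one_lt_cof_iff.1 (one_lt_aleph0.trans_le hinf))
  · exact (not_le.1 hinf).trans_le hμ.aleph0_le

/-- In `μ⁺`, clubs contain cofinally many points of cofinality `ω₁` closed under a given
operation. -/
theorem exists_mem_club_closed {V : Type u} {μ : Cardinal.{u}} (hμ : ℵ₀ < μ)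
    {C : Set (Set.Iio (succ μ).ord)} (hC : IsClub C) {o : V → Ordinal.{u}}
    (ho : ∀ x, o x < (succ μ).ord) {Q : Ordinal.{u} → Set V} (hQ : ∀ η, #(Q η) ≤ μ)
    {β : Ordinal.{u}} (hβ : β < (succ μ).ord) :
    ∃ α ∈ C, β < α.1 ∧ ℵ₀ < α.1.cof ∧ ∀ η < α.1, ∀ x ∈ Q η, o x < α.1 := by
  have hcof : (succ μ).ord.cof = succ μ := (isRegular_succ hμ.le).cof_ord
  have hlim : IsSuccLimit (succ μ).ord := isSuccLimit_ord (hμ.le.trans (le_succ μ))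
  have step : ∀ β : Ordinal.{u}, ∃ γ, β < (succ μ).ord → ∃ h : γ < (succ μ).ord,
      (⟨γ, h⟩ : Set.Iio (succ μ).ord) ∈ C ∧ β < γ ∧ ∀ η ≤ β, ∀ x ∈ Q η, o x < γ := by
    intro β
    by_cases hβ : β < (succ μ).ord
    swap
    · exact ⟨0, fun h => absurd h hβ⟩
    let R : Set V := ⋃ η : Set.Iio (succ β), Q η
    have hR : #R ≤ μ := by
      refine mk_iUnion_le_of_forall_le hμ.le ?_ fun η => hQ η
      rw [mk_Iio_ordinal, lift_lift, lift_le]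
      exact lt_succ_iff.1 (lt_ord.1 (hlim.succ_lt hβ))
    have hsup : ⨆ x : R, o x + 1 < (succ μ).ord :=
      Ordinal.iSup_add_one_lt_of_lt_cof (by rw [hcof]; exact lt_succ_of_le hR) fun x => ho x
    obtain ⟨γ, hγ, hle⟩ := hC.isCofinal
      ⟨max (succ β) (⨆ x : R, o x + 1), max_lt (hlim.succ_lt hβ) hsup⟩
    refine ⟨γ.1, fun _ => ⟨γ.2, hγ, ?_, fun η hη x hx => ?_⟩⟩
    · exact (lt_succ β).trans_le ((le_max_left _ _).trans hle)
    · have hx' : x ∈ R := Set.mem_iUnion.2 ⟨⟨η, lt_succ_of_le hη⟩, hx⟩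
      exact (Ordinal.lt_iSup_add_one (fun x : R => o x) ⟨x, hx'⟩).trans_le
        ((le_max_right _ _).trans hle)
  choose h hh using step
  -- Iterating `h` along `ω₁` makes the supremum a point of cofinality `ω₁`; it stays below `μ⁺`
  -- because `ℵ₁ ≤ μ`.
  let a : Ordinal.{u} → Ordinal.{u} := WellFounded.fix (C := fun _ => Ordinal.{u})
    (wellFounded_lt (α := Ordinal.{u})) fun i g => max β (⨆ j : Set.Iio i, h (g j.1 j.2))
  have ha : ∀ i, a i = max β (⨆ j : Set.Iio i, h (a j.1)) := fun i => WellFounded.fix_eq _ _ i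
  have hω : ∀ i ≤ Ordinal.omega.{u} 1, Cardinal.lift.{u} #(Set.Iio i) <
      (Ordinal.lift.{u + 1} (succ μ).ord).cof := by
    intro i hi
    rw [mk_Iio_ordinal, lift_lift, ← Ordinal.lift_cof, lift_lt, hcof]
    refine (Ordinal.card_le_card hi).trans_lt ?_
    rw [Ordinal.card_omega, lt_succ_iff, ← succ_aleph0]
    exact succ_le_of_lt hμ
  have hlt : ∀ i < Ordinal.omega.{u} 1, a i < (succ μ).ord := by
    intro i
    induction i using WellFoundedLT.induction with
    | ind i ih =>
      intro hi
      rw [ha]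
      refine max_lt hβ (Ordinal.lift_iSup_lt_of_lt_cof (hω i hi.le) fun j => ?_)
      exact (hh _ (ih j.1 j.2 (lt_trans j.2 hi))).1
  have hle : ∀ i j, j < i → h (a j) ≤ a i := by
    intro i j hji
    rw [ha i]
    exact (Ordinal.le_iSup (fun j : Set.Iio i => h (a j.1)) ⟨j, hji⟩).trans (le_max_right _ _)
  have hstep : ∀ j < Ordinal.omega.{u} 1, ∀ i, j < i → a j < a i := fun j hj i hji =>
    (hh _ (hlt j hj)).2.2.1.trans_le (hle i j hji)
  have hωlim : IsSuccLimit (Ordinal.omega.{u} 1) := isSuccLimit_omega 1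
  let f : Set.Iio (Ordinal.omega.{u} 1) → Ordinal.{u} := fun i => a i
  have hf : StrictMono f := fun i j hij => hstep i i.2 j hij
  have hα : ⨆ i, f i < (succ μ).ord :=
    Ordinal.lift_iSup_lt_of_lt_cof (hω _ le_rfl) fun i => hlt i i.2
  have hfα : ∀ i, f i < ⨆ i, f i := fun i =>
    (hf (show i < ⟨succ i.1, hωlim.succ_lt i.2⟩ from lt_succ i.1)).trans_le (Ordinal.le_iSup f _)
  have hhα : ∀ i, h (f i) < ⨆ i, f i := fun i =>
    (hle (succ i.1) i.1 (lt_succ i.1)).trans_lt (hfα ⟨succ i.1, hωlim.succ_lt i.2⟩)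
  have hβα : β < ⨆ i, f i := by
    refine lt_of_le_of_lt ?_ (hfα ⟨0, hωlim.bot_lt⟩)
    exact (le_max_left _ _).trans (ha 0).ge
  refine ⟨⟨_, hα⟩, hC.mem_of_forall_lt_exists (ne_bot_of_gt hβα) fun η hη => ?_, hβα, ?_,
    fun η hη x hx => ?_⟩
  · obtain ⟨i, hi⟩ := Ordinal.lt_iSup_iff.1 hη
    obtain ⟨h1, h2, h3, -⟩ := hh _ (hlt i i.2)
    exact ⟨_, h2, hi.trans h3, (hhα i).le⟩
  · rw [Ordinal.cof_iSup_Iio hf hωlim.isSuccPrelimit, cof_omega_one]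
    exact aleph0_lt_aleph_one
  · obtain ⟨i, hi⟩ := Ordinal.lt_iSup_iff.1 hη
    obtain ⟨h1, -, -, h4⟩ := hh _ (hlt i i.2)
    exact (h4 η hi.le x hx).trans (hhα i)

end Cardinal

/-! ### Ranks from approachability -/

namespace SimpleGraph

variable {V : Type u}

/-- The rank of `x` is the least point of `P` above `o x`, so neighbours of lower rank lie below the
supremum `δ` of the points of `P` up to `o x`. If `δ` has uncountable cofinality it is itself in
`P`; otherwise countably many points of `P` suffice to cover `δ`. Hence closure of `P` is needed
only at uncountable cofinality. -/
theorem exists_rank_of_unbounded {G : SimpleGraph V} {o : V → Ordinal.{u}}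
    (hinj : Function.Injective o) (ho : ∀ x, o x < (#V).ord) {P : Ordinal.{u} → Prop}
    (hlt : ∀ α, P α → α < (#V).ord)
    (hgood : ∀ α, P α → ∀ y, α ≤ o y → (G.neighborSet y ∩ {x | o x < α}).Countable)
    (hunb : ∀ β < (#V).ord, ∃ α, P α ∧ β < α)
    (hclosed : ∀ δ < (#V).ord, ℵ₀ < δ.cof → (∀ η < δ, ∃ α, P α ∧ η < α ∧ α ≤ δ) → P δ) :
    ∃ ρ : V → Ordinal.{u}, (∀ x, (G.neighborSet x ∩ {y | ρ y < ρ x}).Countable) ∧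
      ∀ x, #{y | ρ y = ρ x} < #V := by
  let ρ : V → Ordinal.{u} := fun x => sInf {α | P α ∧ o x < α}
  have hmem : ∀ x, P (ρ x) ∧ o x < ρ x := fun x =>
    csInf_mem (s := {α | P α ∧ o x < α}) (hunb _ (ho x))
  refine ⟨ρ, fun x => ?_, fun x => ?_⟩
  · let T : Set Ordinal.{u} := {α | P α ∧ α ≤ o x}
    have hbdd : BddAbove T := ⟨o x, fun α hα => hα.2⟩
    have hδx : sSup T ≤ o x := csSup_le' fun α hα => hα.2
    have hsub : G.neighborSet x ∩ {y | ρ y < ρ x} ⊆ G.neighborSet x ∩ {y | o y < sSup T} := by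
      rintro y ⟨hadj, hy⟩
      refine ⟨hadj, (hmem y).2.trans_le (le_csSup hbdd ⟨(hmem y).1, ?_⟩)⟩
      by_contra hcon
      exact (show ρ y < ρ x from hy).not_ge
        (csInf_le' (s := {α | P α ∧ o x < α}) ⟨(hmem y).1, not_le.1 hcon⟩)
    refine Set.Countable.mono hsub ?_
    have hlim : ∀ η < sSup T, ∃ α ∈ T, η < α := by
      intro η hη
      by_contra! hcon
      exact absurd hη (not_lt.2 (csSup_le' hcon))
    rcases eq_or_ne (sSup T) 0 with h0 | h0
    · rw [h0]
      simp
    rcases lt_or_ge ℵ₀ (sSup T).cof with hcof | hcof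
    · refine hgood _ (hclosed _ (hδx.trans_lt (ho x)) hcof fun η hη => ?_) x hδx
      obtain ⟨α, hα, hηα⟩ := hlim η hη
      exact ⟨α, hα.1, hηα, le_csSup hbdd hα⟩
    · obtain ⟨s, hs, hcofinal⟩ := Ordinal.exists_nat_cofinal_of_cof_le h0 hcof
      choose t ht hst using fun n => hlim (s n) (hs n)
      refine (Set.countable_iUnion fun n => hgood _ (ht n).1 x (ht n).2).mono ?_
      rintro y ⟨hadj, hy⟩
      obtain ⟨n, hn⟩ := hcofinal _ hy
      exact Set.mem_iUnion.2 ⟨n, hadj, hn.trans_lt (hst n)⟩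
  · have hsub : {y | ρ y = ρ x} ⊆ {y | o y < ρ x} := fun y hy =>
      (show ρ y = ρ x from hy) ▸ (hmem y).2
    exact (mk_le_mk_of_subset hsub).trans_lt
      ((mk_lt_preimage_le hinj _).trans_lt (lt_ord.1 (hlt _ (hmem x).1)))

/-- Cut each initial segment into countably many pieces `e ξ n` of size at most `ν n < μ`, and let
`Q η` collect the vertices with infinitely many neighbours in some `E (c η) n`. If `y` lies above
`α` and has infinitely many neighbours in `E (c α) n`, countably many of them use indices bounded in
`α`; these lie in some `c η` with `η < α`, so `y ∈ Q η` is below `α`, a contradiction. -/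
theorem CountableCommonNeighbors.exists_bounding_sets {G : SimpleGraph V}
    (h : G.CountableCommonNeighbors) {μ : Cardinal.{u}} (hμ : μ.IsSingular)
    (hcof : μ.ord.cof = ℵ₀) (hpow : ∀ ν : Cardinal.{u}, ν.IsRegular → ℵ₀ < ν → ν < μ → ν ^ ℵ₀ = ν)
    {o : V → Ordinal.{u}} (hinj : Function.Injective o) (c : Ordinal.{u} → Set Ordinal.{u}) :
    ∃ Q : Ordinal.{u} → Set V, (∀ η, #(Q η) ≤ μ) ∧ ∀ α < (succ μ).ord, ℵ₀ < α.cof →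
      c α ⊆ Set.Iio α → (∀ β < α, ∃ γ ∈ c α, β ≤ γ) →
      Ordinal.type (fun a b : c α => a < b) = Ordinal.lift.{u + 1} α.cof.ord →
      (∀ ξ < α, ∃ η < α, c α ∩ Set.Iio ξ = c η) → (∀ η < α, ∀ x ∈ Q η, o x < α) →
      ∀ y, α ≤ o y → (G.neighborSet y ∩ {x | o x < α}).Countable := by
  obtain ⟨ν, hν, hdec⟩ := exists_nat_decomposition hμ.aleph0_le hcof V
  have he : ∀ ξ : Ordinal.{u}, ∃ e : ℕ → Set V,
      (ξ < (succ μ).ord → {x | o x < ξ} ⊆ ⋃ n, e n) ∧ ∀ n, #(e n) ≤ ν n := by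
    intro ξ
    by_cases hξ : ξ < (succ μ).ord
    · obtain ⟨e, h1, h2⟩ := hdec {x | o x < ξ}
        ((mk_lt_preimage_le hinj ξ).trans (lt_succ_iff.1 (lt_ord.1 hξ)))
      exact ⟨e, fun _ => h1, h2⟩
    · exact ⟨fun _ => ∅, fun h => absurd h hξ, fun n => by simp⟩
  choose e hcover hcard using he
  let E : Set Ordinal.{u} → ℕ → Set V := fun d n => ⋃ ξ : d, e ξ n
  have hE : ∀ (d : Set Ordinal.{u}) (n : ℕ), #d < Cardinal.lift.{u + 1} μ →
      #(G.infiniteNeighbors (E d n)) ≤ μ := by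
    intro d n hd
    obtain ⟨τ, hτ, hτd⟩ := Cardinal.lt_lift_iff.1 hd
    -- A successor is regular, so `θ ^ ℵ₀ = θ`; it stays below `μ` because `μ` is a limit cardinal.
    let θ := succ (max ℵ₀ (max τ (ν n)))
    have hlim := hμ.isSuccLimit
    have hω : ℵ₀ < μ := lt_of_le_of_ne hμ.aleph0_le (by
      rintro rfl; exact not_isSingular_aleph0 hμ)
    have hθ : θ < μ := hlim.succ_lt (max_lt hω (max_lt hτ (hν n)))
    have h0 : ℵ₀ < θ := lt_succ_of_le (le_max_left _ _)
    have h1 : τ ≤ θ := ((le_max_left _ _).trans (le_max_right _ _)).trans (le_succ _)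
    have h2 : ν n ≤ θ := ((le_max_right _ _).trans (le_max_right _ _)).trans (le_succ _)
    refine (h.mk_infiniteNeighbors_le h0.le
      (hpow θ (isRegular_succ (le_max_left _ _)) h0 hθ) ?_).trans hθ.le
    refine mk_iUnion_le_of_forall_le h0.le ?_ fun ξ => (hcard ξ n).trans h2
    rw [← hτd, lift_lift, lift_le]
    exact h1
  -- The clause on `#(c η)` empties `Q η` where `c η` is too large, so the size bound holds for
  -- every `η`.
  refine ⟨fun η => ⋃ n, {y | y ∈ G.infiniteNeighbors (E (c η) n) ∧
    #(c η) < Cardinal.lift.{u + 1} μ}, fun η => ?_, ?_⟩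
  · refine mk_iUnion_le_of_forall_le hμ.aleph0_le (by simpa using hμ.aleph0_le) fun n => ?_
    by_cases hη : #(c η) < Cardinal.lift.{u + 1} μ
    · exact (mk_le_mk_of_subset fun y hy => hy.1).trans (hE _ n hη)
    · simp [hη]
  intro α hα hαcof hcα hunb htype hinit hclosed y hy
  have hcμ : #(c α) < Cardinal.lift.{u + 1} μ := by
    have := congrArg Ordinal.card htype
    rw [Ordinal.card_type, ← Ordinal.lift_card, card_ord] at this
    rw [this, lift_lt]
    exact hμ.cof_lt_of_lt_ord_succ hα
  have hαlim : IsSuccLimit α := Ordinal.one_lt_cof_iff.1 (one_lt_aleph0.trans hαcof)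
  have hsub : G.neighborSet y ∩ {x | o x < α} ⊆ ⋃ n, G.neighborSet y ∩ E (c α) n := by
    rintro x ⟨hadj, hx⟩
    obtain ⟨ξ, hξ, hle⟩ := hunb _ (hαlim.succ_lt hx)
    obtain ⟨n, hn⟩ := Set.mem_iUnion.1
      (hcover ξ (lt_trans (hcα hξ) hα) ((lt_succ (o x)).trans_le hle))
    exact Set.mem_iUnion.2 ⟨n, hadj, Set.mem_iUnion.2 ⟨⟨ξ, hξ⟩, hn⟩⟩
  refine (Set.countable_iUnion fun n => ?_).mono hsub
  refine Set.Finite.countable ?_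
  by_contra hinf
  let g := Set.Infinite.natEmbedding _ hinf
  choose ξ hξ using fun k => Set.mem_iUnion.1 (g k).2.2
  -- Uncountable cofinality bounds the chosen indices below `α`.
  have hsup : ⨆ k, (ξ k).1 + 1 < α :=
    Ordinal.lift_iSup_add_one_lt_of_lt_cof (by simpa using hαcof) fun k => hcα (ξ k).2
  obtain ⟨η, hη, hηeq⟩ := hinit _ hsup
  refine absurd (hclosed η hη y (Set.mem_iUnion.2 ⟨n, ?_, ?_⟩)) (not_lt.2 hy)
  · refine Set.Infinite.mono ?_ (Set.infinite_range_of_injective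
      (Subtype.val_injective.comp g.injective))
    rintro _ ⟨k, rfl⟩
    refine ⟨(g k).2.1, Set.mem_iUnion.2 ⟨⟨ξ k, ?_⟩, hξ k⟩⟩
    rw [← hηeq]
    exact ⟨(ξ k).2, Ordinal.lt_iSup_add_one (fun k => (ξ k).1) k⟩
  · rw [← hηeq]
    exact (mk_le_mk_of_subset Set.inter_subset_left).trans_lt hcμ

theorem CountableCommonNeighbors.exists_rank_of_approachability {G : SimpleGraph V}
    (h : G.CountableCommonNeighbors) {μ : Cardinal.{u}} (hV : #V = succ μ) (hμ : μ.IsSingular)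
    (hcof : μ.ord.cof = ℵ₀) (hpow : ∀ ν : Cardinal.{u}, ν.IsRegular → ℵ₀ < ν → ν < μ → ν ^ ℵ₀ = ν)
    (hAP : ApproachabilityPrinciple μ) :
    ∃ ρ : V → Ordinal.{u}, (∀ x, (G.neighborSet x ∩ {y | ρ y < ρ x}).Countable) ∧
      ∀ x, #{y | ρ y = ρ x} < #V := by
  obtain ⟨o, hinj, ho⟩ := exists_injective_lt_ord V
  obtain ⟨c, hc, C, hC, hCc⟩ := hAP
  obtain ⟨Q, hQ, hgood⟩ := h.exists_bounding_sets hμ hcof hpow hinj c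
  have hω : ℵ₀ < μ := lt_of_le_of_ne hμ.aleph0_le (by
    rintro rfl; exact not_isSingular_aleph0 hμ)
  have ho' : ∀ x, o x < (succ μ).ord := hV ▸ ho
  refine exists_rank_of_unbounded hinj ho (P := fun α => ∃ hα : α < (succ μ).ord,
    (⟨α, hα⟩ : Set.Iio (succ μ).ord) ∈ C ∧ ℵ₀ < α.cof ∧ ∀ η < α, ∀ x ∈ Q η, o x < α) ?_ ?_ ?_ ?_
  · rintro α ⟨hα, -⟩
    rwa [hV]
  · rintro α ⟨hα, hαC, hαcof, hclosed⟩
    obtain ⟨h1, h2, h3⟩ := hCc ⟨α, hα⟩ hαC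
    exact hgood α hα hαcof (hc α hα) h1 h2 h3 hclosed
  · intro β hβ
    obtain ⟨α, hαC, hβα, hαcof, hclosed⟩ :=
      Cardinal.exists_mem_club_closed hω hC ho' hQ (hV ▸ hβ)
    exact ⟨α.1, ⟨α.2, hαC, hαcof, hclosed⟩, hβα⟩
  · intro δ hδ hδcof hlim
    rw [hV] at hδ
    have h0 : δ ≠ 0 := by
      rintro rfl
      simp at hδcof
    refine ⟨hδ, hC.mem_of_forall_lt_exists (δ := ⟨δ, hδ⟩) h0 fun η hη => ?_, hδcof,
      fun η hη x hx => ?_⟩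
    · obtain ⟨α, ⟨hα, hαC, -⟩, hηα, hle⟩ := hlim η hη
      exact ⟨_, hαC, hηα, hle⟩
    · obtain ⟨α, ⟨hα, hαC, -, hclosed⟩, hηα, hle⟩ := hlim η hη
      exact (hclosed η hηα x hx).trans_le hle

end SimpleGraph

/-! ### The induction on the number of vertices -/

namespace Cardinal

/-- By uncountable cofinality every `ω`-sequence in `μ` is bounded, so the sequences form a union of
`μ` sets of size at most `μ`. -/
theorem power_aleph0_eq_of_forall_lt {μ : Cardinal.{u}} (hμ : ℵ₀ ≤ μ) (hcof : ℵ₀ < μ.ord.cof)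
    (h : ∀ ν < μ, ν ^ ℵ₀ ≤ μ) : μ ^ ℵ₀ = μ := by
  refine le_antisymm ?_ (self_le_power _ one_le_aleph0)
  induction μ using Cardinal.inductionOn with
  | mk α =>
  obtain ⟨o, hinj, ho⟩ := exists_injective_lt_ord α
  let S : Set.Iio (#α).ord → Set (ℕ → α) := fun β => {f | ∀ n, o (f n) < β}
  have hcover : (⋃ β, S β) = Set.univ := by
    refine Set.eq_univ_of_forall fun f => Set.mem_iUnion.2 ⟨⟨⨆ n, o (f n) + 1, ?_⟩, fun n => ?_⟩
    · exact Ordinal.lift_iSup_add_one_lt_of_lt_cof (by simpa using hcof) fun n => ho _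
    · exact Ordinal.lt_iSup_add_one (fun n => o (f n)) n
  have hS : ∀ β, #(S β) ≤ #α := by
    intro β
    refine le_trans ?_ (h _ ((mk_lt_preimage_le hinj β.1).trans_lt (lt_ord.1 β.2)))
    have h1 : #{x | o x < β.1} ^ ℵ₀ = #(ℕ → {x | o x < β.1}) := by simp
    rw [h1]
    refine mk_le_of_injective (f := fun f n => ⟨f.1 n, f.2 n⟩) fun f g hfg => ?_
    exact Subtype.ext (funext fun n => congrArg Subtype.val (congrFun hfg n))
  have h2 : #α ^ ℵ₀ = #(Set.univ : Set (ℕ → α)) := by simp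
  rw [h2, ← hcover]
  refine mk_iUnion_le_of_forall_le hμ ?_ hS
  rw [mk_Iio_ordinal, lift_lift, card_ord]

end Cardinal

namespace SimpleGraph

theorem hasColoringOrder_aleph_one_of_mk_le {V : Type u} {G : SimpleGraph V} (hV : #V ≤ ℵ₁) :
    G.HasColoringOrder ℵ₁ := by
  obtain ⟨o, hinj, ho⟩ := exists_injective_lt_ord V
  refine hasColoringOrder_of_injective o hinj fun x => ?_
  exact ((mk_le_mk_of_subset fun y hy => hy.2).trans (mk_lt_preimage_le hinj _)).trans_lt
    ((lt_ord.1 (ho x)).trans_le hV)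

theorem CountableCommonNeighbors.hasColoringOrder {κ : Cardinal.{u}}
    (hpow : ∀ μ : Cardinal.{u}, μ.IsRegular → ℵ₀ < μ → μ < κ → μ ^ ℵ₀ = μ)
    (hAP : ∀ μ : Cardinal.{u}, μ.IsSingular → μ.ord.cof = ℵ₀ → μ < κ →
      ApproachabilityPrinciple μ) {V : Type u} {G : SimpleGraph V} (hV : #V ≤ κ)
    (h : G.CountableCommonNeighbors) : G.HasColoringOrder ℵ₁ := by
  induction hc : #V using WellFoundedLT.induction generalizing V with
  | ind c ih =>
  subst hc
  rcases le_or_gt #V ℵ₁ with hle | hlt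
  · exact hasColoringOrder_aleph_one_of_mk_le hle
  suffices H : ∃ ρ : V → Ordinal.{u}, (∀ x, (G.neighborSet x ∩ {y | ρ y < ρ x}).Countable) ∧
      ∀ x, #{y | ρ y = ρ x} < #V by
    obtain ⟨ρ, h1, h2⟩ := H
    exact hasColoringOrder_aleph_one_of_rank ρ h1 fun x =>
      ih _ (h2 x) ((h2 x).le.trans hV) (h.induce _) rfl
  have hreg : ∀ ν < #V, (succ (max ν ℵ₀)) < #V → ∃ μ < #V, ν ≤ μ ∧ ℵ₀ ≤ μ ∧ μ ^ ℵ₀ = μ := by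
    intro ν hν hs
    have h0 : ℵ₀ < succ (max ν ℵ₀) := lt_succ_of_le (le_max_right _ _)
    exact ⟨_, hs, (le_max_left _ _).trans (le_succ _), h0.le,
      hpow _ (isRegular_succ (le_max_right _ _)) h0 (hs.trans_le hV)⟩
  have hω : ℵ₀ < #V := aleph0_lt_aleph_one.trans hlt
  by_cases hs : ∃ μ, succ μ = #V
  swap
  · refine h.exists_rank_of_power fun ν hν => hreg ν hν ?_
    exact lt_of_le_of_ne (succ_le_of_lt (max_lt hν hω)) fun h => hs ⟨_, h⟩
  obtain ⟨μ, hμ⟩ := hs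
  have hμV : μ < #V := hμ ▸ lt_succ μ
  have hμω : ℵ₀ < μ := by
    rw [← hμ, lt_succ_iff] at hlt
    exact aleph0_lt_aleph_one.trans_le hlt
  by_cases hsing : μ.IsSingular ∧ μ.ord.cof = ℵ₀
  · exact h.exists_rank_of_approachability hμ.symm hsing.1 hsing.2
      (fun ν h1 h2 h3 => hpow ν h1 h2 (h3.trans (hμV.trans_le hV)))
      (hAP μ hsing.1 hsing.2 (hμV.trans_le hV))
  -- Here `μ` is regular or singular of uncountable cofinality; in the latter case regular
  -- successors are cofinal below `μ`.
  have hμpow : μ ^ ℵ₀ = μ := by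
    rcases isRegular_or_isSingular hμω.le with hr | hr
    · exact hpow μ hr hμω (hμV.trans_le hV)
    · refine power_aleph0_eq_of_forall_lt hμω.le ?_ fun ν hν => ?_
      · refine lt_of_le_of_ne ?_ fun h => hsing ⟨hr, h.symm⟩
        exact Ordinal.aleph0_le_cof_iff.2 (Ordinal.one_lt_cof_iff.2 (isSuccLimit_ord hμω.le))
      · have hθ := hr.isSuccLimit.succ_lt (max_lt hν hμω)
        have h0 : ℵ₀ < succ (max ν ℵ₀) := lt_succ_of_le (le_max_right _ _)
        refine (power_le_power_right ((le_max_left ν ℵ₀).trans (le_succ _))).trans ?_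
        rw [hpow _ (isRegular_succ (le_max_right _ _)) h0 (hθ.trans (hμV.trans_le hV))]
        exact hθ.le
  refine h.exists_rank_of_power fun ν hν => ⟨μ, hμV, ?_, hμω.le, hμpow⟩
  rwa [← hμ, lt_succ_iff] at hν

/-! ### List colorings and the subgraph `K_{ω,ω₁}` -/

theorem IsListColorable.mono {V : Type u} {G : SimpleGraph V} {κ κ' : Cardinal.{u}}
    (h : G.IsListColorable κ) (hle : κ ≤ κ') : G.IsListColorable κ' := by
  intro F hF
  have hsub : ∀ x, ∃ p ⊆ F x, #p = Cardinal.lift.{u + 1} κ := fun x =>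
    le_mk_iff_exists_subset.1 ((hF x).symm ▸ Cardinal.lift_le.2 hle)
  choose F' hF' hcard using hsub
  obtain ⟨f, hf, hmem⟩ := h F' hcard
  exact ⟨f, hf, fun x => hF' x (hmem x)⟩

/-- The complete bipartite graph between `ℕ` and a set of size at least the continuum has
uncountable list-chromatic number. -/
theorem aleph0_lt_listChromaticNumber_of_iso {W : Type u} {B : Type v} {G : SimpleGraph W}
    (e : completeBipartiteGraph ℕ B ≃g G) {φ : B → ℕ → ℕ} (hφ : Function.Surjective φ) :
    ℵ₀ < G.listChromaticNumber := by
  by_contra! hle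
  have hmem : G.IsListColorable G.listChromaticNumber :=
    csInf_mem (s := {κ | G.IsListColorable κ}) ⟨_, G.isListColorable_succ_mk⟩
  have hcol := hmem.mono hle
  let code : ℕ → ℕ → Ordinal.{u} := fun n k => (Nat.pair n k : ℕ)
  have hcode : ∀ {n k n' k'}, code n k = code n' k' → n = n' ∧ k = k' := fun h =>
    Nat.pair_eq_pair.1 (Nat.cast_injective h)
  -- The lists on the left are disjoint copies of `ω`; `b` receives the graph of `φ b`. If the left
  -- side is colored by `ψ = φ b`, every color in the list of `b` is already used by a neighbour.
  let F : ℕ ⊕ B → Set Ordinal.{u} := Sum.elim (fun n => Set.range (code n))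
    fun b => Set.range fun n => code n (φ b n)
  have hF : ∀ x, #(F x) = ℵ₀ := by
    have key : ∀ g : ℕ → Ordinal.{u}, Function.Injective g → #(Set.range g) = ℵ₀ := by
      intro g hg
      simpa using mk_range_eq_of_injective hg
    rintro (n | b)
    · exact key _ fun k k' h => (hcode h).2
    · exact key _ fun n n' h => (hcode h).1
  obtain ⟨f, hf, hfF⟩ := hcol (fun w => F (e.symm w)) fun w => by simpa using hF _
  have hleft : ∀ n, ∃ k, code n k = f (e (Sum.inl n)) := fun n => by
    simpa [F] using hfF (e (Sum.inl n))
  choose ψ hψ using hleft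
  obtain ⟨b, hb⟩ := hφ ψ
  have hright : ∃ n, code n (φ b n) = f (e (Sum.inr b)) := by
    simpa [F] using hfF (e (Sum.inr b))
  obtain ⟨n, hn⟩ := hright
  refine hf (e (Sum.inl n)) (e (Sum.inr b)) (e.map_adj_iff.2 (by simp)) ?_
  rw [← hψ, ← hn, hb]

/-- A graph with an infinite set of vertices that have uncountably many common neighbours contains
the complete bipartite graph `K_{ω,ω₁}`. -/
theorem exists_subgraph_iso_of_not_countableCommonNeighbors {V : Type u} {G : SimpleGraph V}
    (h : ¬ G.CountableCommonNeighbors) : ∃ H : G.Subgraph,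
      Nonempty (completeBipartiteGraph ℕ (Quotient.out (ℵ₁ : Cardinal.{u})) ≃g H.coe) := by
  unfold CountableCommonNeighbors at h
  push Not at h
  obtain ⟨A, hA, hB⟩ := h
  have hB' : ℵ₁ ≤ #{y | ∀ x ∈ A, G.Adj y x} :=
    not_lt.1 fun hlt => hB (countable_iff_mk_lt_aleph_one.2 hlt)
  rw [← mk_out ℵ₁, le_def] at hB'
  obtain ⟨b⟩ := hB'
  let a := Set.Infinite.natEmbedding A hA
  have hadj : ∀ n i, G.Adj (a n) (b i) := fun n i => ((b i).2 _ (a n).2).symm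
  let f : completeBipartiteGraph ℕ (Quotient.out (ℵ₁ : Cardinal.{u})) →g G :=
    { toFun := Sum.elim (fun n => (a n : V)) (fun i => (b i : V))
      map_rel' := by
        rintro (n | i) (m | j) hij
        · simp at hij
        · exact hadj n j
        · exact (hadj m i).symm
        · simp at hij }
  have hf : Function.Injective f := by
    rintro (n | i) (m | j) hij
    · exact congrArg Sum.inl (a.injective (Subtype.ext hij))
    · exact absurd hij (hadj n j).ne
    · exact absurd hij.symm (hadj m i).ne
    · exact congrArg Sum.inr (b.injective (Subtype.ext hij))
  exact ⟨_, ⟨(Copy.mk f hf).isoToSubgraph⟩⟩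

end SimpleGraph

theorem proposition1p8 {V : Type u} (X : SimpleGraph V)
    (hCol : ℵ₁ < X.coloringNumber)
    (hpow : ∀ μ : Cardinal.{u}, μ.IsRegular → ℵ₀ < μ → μ < #V → μ ^ ℵ₀ = μ)
    (hAP : ∀ μ : Cardinal.{u}, μ.IsSingular → μ.ord.cof = ℵ₀ → μ < #V →
      ApproachabilityPrinciple μ) :
    (∃ H : X.Subgraph,
      Nonempty (completeBipartiteGraph ℕ (Quotient.out (ℵ₁ : Cardinal.{u})) ≃g H.coe)) ∧
    (∃ H : X.Subgraph, #H.verts = ℵ₁ ∧ ℵ₀ < H.coe.listChromaticNumber) := by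
  have hnot : ¬ X.HasColoringOrder ℵ₁ := notMem_of_lt_csInf' (s := {κ | X.HasColoringOrder κ}) hCol
  obtain ⟨H, ⟨e⟩⟩ := SimpleGraph.exists_subgraph_iso_of_not_countableCommonNeighbors
    fun h => hnot (h.hasColoringOrder hpow hAP le_rfl)
  refine ⟨⟨H, ⟨e⟩⟩, H, ?_, ?_⟩
  · rw [← mk_congr e.toEquiv]
    simpa using add_eq_right aleph0_lt_aleph_one.le aleph0_lt_aleph_one.le
  · have hV : ℵ₁ < #V :=
      not_le.1 fun hle => hnot (SimpleGraph.hasColoringOrder_aleph_one_of_mk_le hle)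
    -- This gives CH, hence an injection of `ℕ → ℕ` into the `ω₁` side; its left inverse is the
    -- required surjection.
    have hCH : ℵ₁ ^ ℵ₀ = (ℵ₁ : Cardinal.{u}) :=
      hpow _ isRegular_aleph_one aleph0_lt_aleph_one hV
    have hle : Cardinal.lift.{u} #(ℕ → ℕ) ≤
        Cardinal.lift.{0} #(Quotient.out (ℵ₁ : Cardinal.{u})) := by
      have h1 : (ℵ₀ : Cardinal.{u}) ^ (ℵ₀ : Cardinal.{u}) ≤ ℵ₁ :=
        hCH ▸ power_le_power_right aleph0_lt_aleph_one.le
      simpa using h1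
    obtain ⟨g⟩ := Cardinal.lift_mk_le'.1 hle
    exact SimpleGraph.aleph0_lt_listChromaticNumber_of_iso e (Function.invFun_surjective g.injective)
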